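/- Let $G=(\mathcal V,\mathcal E)$ be a finite graph, and let $J_e\ge 0$ $(e\in\mathcal E)$ and $\lambda_v\ge 0$ $(v\in\mathcal V)$ be real numbers. For $J_e>0$ put $$V_e(\theta)=\sum_{m\in\mathbb Z}\exp\Big(-\frac{J_e}{2}(\theta+2\pi m)^2\Big),$$ and for $J_e=0$ (where this series diverges) put $V_e\equiv 1$, i.e. the edge $e$ carries no interaction. Let $(\Theta_v)_{v\in\mathcal V}$ be distributed according to the Villain model on $G$ with free boundary conditions, that is, according to the probability measure $$Z_G^{-1}\prod_{e=\{u,v\}\in\mathcal E}V_e(\theta_u-\theta_v)\prod_{v\in\mathcal V}d\theta_v,\qquad \theta_v\in(-\pi,\pi],$$ where $d\theta_v$ is Lebesgue measure on $(-\pi,\pi]$ and $Z_G$ is the normalizing constant, and let $\mu_\lambda$ be the distribution of $\sum_{v}\lambda_v\cos\Theta_v$. Then this is a well-defined probability measure, the function $$f_V(z)=\mathbb E\Big[\exp\Big(z\sum_{v\in\mathcal V}\lambda_v\cos\Theta_v\Big)\Big]=\int_{-\infty}^{\infty}e^{zx}\,d\mu_\lambda(x)$$ is well defined for every $z\in\mathbb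 C$ (the integrands are integrable), and all zeros of $f_V$ are purely imaginary: if $f_V(z)=0$ then $\operatorname{Re} z=0$. -/

import Mathlib

open MeasureTheory

namespace Villain

/-- The edge weight of the Villain model, the periodized Gaussian
`V_J(θ) = ∑_{m ∈ ℤ} exp (-(J/2) (θ + 2πm)²)` for `J > 0`. At `J = 0` this series diverges; since
`V_J(θ) / V_J(0) → 1` as `J ↓ 0` and constant factors cancel in the normalized measure,
a zero coupling means no interaction, i.e. the constant weight `1`. -/
noncomputable def edgeWeight (J θ : ℝ) : ℝ :=
  if J = 0 then 1 else ∑' m : ℤ, Real.exp (-(J / 2) * (θ + 2 * Real.pi * m) ^ 2)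

theorem edgeWeight_neg (J θ : ℝ) : edgeWeight J (-θ) = edgeWeight J θ := by
  unfold edgeWeight
  split_ifs
  · rfl
  · rw [← (Equiv.neg ℤ).tsum_eq]
    refine tsum_congr fun m => ?_
    congr 2
    simp only [Equiv.neg_apply]
    push_cast
    ring

variable {V : Type*}

/-- The weight `V_e(θ_u - θ_v)` attached to an unordered pair `e = {u, v}` with coupling `J`. -/
noncomputable def pairWeight (J : ℝ) (θ : V → ℝ) (e : Sym2 V) : ℝ :=
  Sym2.lift ⟨fun u v => edgeWeight J (θ u - θ v), fun u v => by
    show edgeWeight J (θ u - θ v) = edgeWeight J (θ v - θ u)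
    rw [← edgeWeight_neg, neg_sub]⟩ e

/-- The unnormalized density `∏_{e = {u,v}} V_e(θ_u - θ_v)`. -/
noncomputable def density (G : SimpleGraph V) [Fintype G.edgeSet] (J : G.edgeSet → ℝ)
    (θ : V → ℝ) : ℝ :=
  ∏ e : G.edgeSet, pairWeight (J e) θ e.1

/-- The unnormalized measure `∏_e V_e(θ_u - θ_v) ∏_v dθ_v` on `(-π, π]^V`. -/
noncomputable def unnormalizedMeasure [Fintype V] (G : SimpleGraph V) [Fintype G.edgeSet]
    (J : G.edgeSet → ℝ) : Measure (V → ℝ) :=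
  (Measure.pi fun _ : V => (volume : Measure ℝ).restrict (Set.Ioc (-Real.pi) Real.pi)).withDensity
    fun θ => ENNReal.ofReal (density G J θ)

/-- The Gibbs measure of the Villain model on `G` with free boundary conditions. -/
noncomputable def gibbsMeasure [Fintype V] (G : SimpleGraph V) [Fintype G.edgeSet]
    (J : G.edgeSet → ℝ) : Measure (V → ℝ) :=
  (unnormalizedMeasure G J Set.univ)⁻¹ • unnormalizedMeasure G J

/-- The random variable `∑_v λ_v cos θ_v`. -/
noncomputable def magnetization [Fintype V] (lam : V → ℝ) (θ : V → ℝ) : ℝ :=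
  ∑ v, lam v * Real.cos (θ v)

/-- The distribution `μ_λ` of `∑_v λ_v cos Θ_v`, where `Θ` has the Villain law. -/
noncomputable def magnetizationLaw [Fintype V] (G : SimpleGraph V) [Fintype G.edgeSet]
    (J : G.edgeSet → ℝ) (lam : V → ℝ) : Measure ℝ :=
  (gibbsMeasure G J).map (magnetization lam)

end Villain

namespace Villain

open Filter Topology

/-! Put x_v = exp(iθ_v). By Poisson summation and the Jacobi triple product, an edge weight with J >
0 is, up to a positive constant, the limit of ∏_{j<n} (1 + q^(2j+1) x_u/x_v)(1 + q^(2j+1) x_v/x_u)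
with q = exp(-1/(2J)). Likewise exp(zλ cos θ) is the limit of (1 + λzx/(2n))^n (1 + λz/(2nx))^n.
With denominators cleared, the factors are x_v + c x_u, 1 + c z x_v and x_v + c z with c ≥ 0; none
of them vanishes when z and all x_v have positive real part.

Integration over the torus extracts one coefficient in x of such a stable product
(`integral_eval_exp_mul`). By a Gauss–Lucas argument, a coefficient of a stable polynomial is, as a
function of z, either identically zero on Re z > 0 or zero-free there
(`eval_coeff_ne_zero_of_stable`). Hurwitz's theorem (`ne_zero_of_tendsto_of_ne_zero`, with locally
uniform convergence phrased as convergence along `l ×ˢ 𝓝 z`) carries this to f_V, which is not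
identically zero because f_V(1) > 0. The rotation θ ↦ θ + π fixes the interaction and exchanges z
with -z, which settles Re z < 0. -/

theorem ne_zero_of_tendsto_of_ne_zero {ι : Type*} {l : Filter ι} [l.NeBot] {U : Set ℂ}
    (hU : IsOpen U) (hU' : IsPreconnected U) {F : ι → ℂ → ℂ} {f : ℂ → ℂ}
    (hF : ∀ᶠ i in l, DifferentiableOn ℂ (F i) U) (hF0 : ∀ᶠ i in l, ∀ z ∈ U, F i z ≠ 0)
    (hf : DifferentiableOn ℂ f U)
    (hlim : ∀ z ∈ U, Tendsto (fun p : ι × ℂ => F p.1 p.2) (l ×ˢ 𝓝 z) (𝓝 (f z)))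
    (hf0 : ∃ z ∈ U, f z ≠ 0) : ∀ z ∈ U, f z ≠ 0 := by
  intro z₀ hz₀ h0
  have han : AnalyticOnNhd ℂ f U := hf.analyticOnNhd hU
  have hne : ∀ᶠ z in 𝓝[≠] z₀, f z ≠ 0 := by
    rcases (han z₀ hz₀).eventually_eq_zero_or_eventually_ne_zero with h | h
    · obtain ⟨z, hz, hz'⟩ := hf0
      exact absurd (han.eqOn_zero_of_preconnected_of_eventuallyEq_zero hU' hz₀ h hz) hz'
    · exact h
  obtain ⟨R, hR, hRU⟩ := Metric.isOpen_iff.1 hU z₀ hz₀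
  obtain ⟨R', hR', hR'f⟩ := Metric.mem_nhdsWithin_iff.1 hne
  obtain ⟨r, hr, hrR⟩ := exists_between (lt_min hR hR')
  have hsub : Metric.closedBall z₀ r ⊆ U :=
    (Metric.closedBall_subset_ball (hrR.trans_le (min_le_left _ _))).trans hRU
  have hS : IsCompact (Metric.sphere z₀ r) := isCompact_sphere z₀ r
  have hSne : (Metric.sphere z₀ r).Nonempty := NormedSpace.sphere_nonempty.2 hr.le
  have hSU : Metric.sphere z₀ r ⊆ U := Metric.sphere_subset_closedBall.trans hsub
  obtain ⟨w, hw, hwmin⟩ := hS.exists_isMinOn hSne (hf.continuousOn.mono hSU).norm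
  have hfw : f w ≠ 0 := by
    refine hR'f ⟨?_, ?_⟩
    · rw [Metric.mem_ball, Metric.mem_sphere.1 hw]
      exact hrR.trans_le (min_le_right _ _)
    · rintro rfl
      simp at hw
      exact hr.ne hw
  set δ := ‖f w‖ / 2 with hδ
  have hδ0 : 0 < δ := by positivity
  -- The zero z₀ is isolated, so |f| ≥ 2δ on a small circle; compactness makes the bound δ for F i
  -- uniform there.
  have hsph : ∀ᶠ i in l, ∀ z ∈ Metric.sphere z₀ r, δ ≤ ‖F i z‖ := by
    have h1 : ∀ᶠ p in l ×ˢ 𝓝ˢ (Metric.sphere z₀ r), δ < ‖F p.1 p.2‖ := by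
      rw [hS.prod_nhdsSet_eq_biSup]
      simp only [eventually_iSup]
      intro z hz
      refine (hlim z (hSU hz)).norm.eventually_const_lt ?_
      have : ‖f w‖ ≤ ‖f z‖ := hwmin hz
      have : 0 < ‖f w‖ := norm_pos_iff.2 hfw
      rw [hδ]; linarith
    obtain ⟨p, hp, q, hq, hpq⟩ := eventually_prod_iff.1 h1
    filter_upwards [hp] with i hi z hz
    exact (hpq hi (subset_of_mem_nhdsSet hq hz)).le
  -- The maximum principle for 1 / F i moves the lower bound from the circle to its centre, where
  -- the limit is 0.
  have hcen : ∀ᶠ i in l, δ ≤ ‖F i z₀‖ := by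
    filter_upwards [hsph, hF, hF0] with i h1 h2 h3
    have hd : DiffContOnCl ℂ (fun z => (F i z)⁻¹) (Metric.ball z₀ r) := by
      apply DifferentiableOn.diffContOnCl
      rw [closure_ball z₀ hr.ne']
      exact (h2.mono hsub).inv fun z hz => h3 z (hsub hz)
    have := Complex.norm_le_of_forall_mem_frontier_norm_le Metric.isBounded_ball hd
      (C := δ⁻¹) (fun z hz => ?_) (subset_closure (Metric.mem_ball_self hr))
    · rw [norm_inv] at this
      exact (inv_le_inv₀ (norm_pos_iff.2 (h3 _ hz₀)) hδ0).1 this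
    · rw [frontier_ball z₀ hr.ne'] at hz
      rw [norm_inv]
      exact inv_anti₀ hδ0 (h1 z hz)
  have hlim0 : Tendsto (fun i => F i z₀) l (𝓝 (f z₀)) :=
    (hlim z₀ hz₀).comp (tendsto_id.prodMk tendsto_const_pure |>.mono_right
      (prod_mono le_rfl (pure_le_nhds z₀)))
  have := ge_of_tendsto hlim0.norm hcen
  rw [h0, norm_zero] at this
  linarith

/-! ### Stable polynomials and their coefficients -/

section Stability

open MvPolynomial

variable {V : Type*}

/-- A polynomial without zeros in the product of open right half planes. -/
def Stable (P : MvPolynomial V ℂ) : Prop :=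
  ∀ s : V → ℂ, (∀ v, 0 < (s v).re) → eval s P ≠ 0

theorem Stable.mul {P Q : MvPolynomial V ℂ} (hP : Stable P) (hQ : Stable Q) : Stable (P * Q) := by
  intro s hs
  rw [map_mul]
  exact mul_ne_zero (hP s hs) (hQ s hs)

theorem derivative_aeval_update [DecidableEq V] (s : V → ℂ) (v : V) (P : MvPolynomial V ℂ) :
    Polynomial.derivative (aeval (Function.update (fun u => Polynomial.C (s u)) v Polynomial.X) P)
      = aeval (Function.update (fun u => Polynomial.C (s u)) v Polynomial.X) (pderiv v P) := by
  induction P using MvPolynomial.induction_on with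
  | C a => simp
  | add p q hp hq => simp [hp, hq]
  | mul_X p u hp =>
    rw [map_mul, Polynomial.derivative_mul, hp, pderiv_mul, map_add, map_mul, map_mul]
    have hu : Polynomial.derivative (aeval (R := ℂ)
        (Function.update (fun u => Polynomial.C (s u)) v Polynomial.X) (X u : MvPolynomial V ℂ))
        = aeval (R := ℂ) (Function.update (fun u => Polynomial.C (s u)) v Polynomial.X)
          (pderiv v (X u : MvPolynomial V ℂ)) := by
      rcases eq_or_ne u v with rfl | h
      · simp
      · simp [pderiv_X_of_ne h, Function.update_of_ne h]
    rw [hu, add_comm]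

theorem eval_aeval_update [DecidableEq V] (s : V → ℂ) (v : V) (x : ℂ) (P : MvPolynomial V ℂ) :
    (aeval (Function.update (fun u => Polynomial.C (s u)) v Polynomial.X) P).eval x
      = eval (Function.update s v x) P := by
  induction P using MvPolynomial.induction_on with
  | C a => simp
  | add p q hp hq => simp [hp, hq]
  | mul_X p u hp =>
    rw [map_mul, Polynomial.eval_mul, hp, map_mul]
    congr 1
    rcases eq_or_ne u v with rfl | h
    · simp
    · simp [Function.update_of_ne h]

/-- As in Gauss–Lucas, q'/q = ∑ 1/(x - root). The roots lie in Re ≤ 0, so each term has nonnegative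
real part, and t > 0 makes the sum t + q'/q nonzero. The shift by t avoids the case q' = 0. -/
theorem add_eval_derivative_ne_zero {q : Polynomial ℂ} (hq : ∀ x : ℂ, 0 < x.re → q.eval x ≠ 0)
    {t : ℝ} (ht : 0 < t) {x : ℂ} (hx : 0 < x.re) :
    (t : ℂ) * q.eval x + q.derivative.eval x ≠ 0 := by
  rw [(IsAlgClosed.splits q).eval_derivative_eq_eval_mul_sum (hq x hx), mul_comm, ← mul_add]
  refine mul_ne_zero (hq x hx) fun h => ?_
  have h' := congrArg Complex.re h
  rw [Complex.add_re, Complex.ofReal_re, Complex.zero_re] at h'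
  have hsum : 0 ≤ ((q.roots.map fun z => 1 / (x - z)).sum).re := by
    rw [← Complex.coe_reAddGroupHom, map_multiset_sum, Multiset.map_map]
    refine Multiset.sum_nonneg fun y hy => ?_
    obtain ⟨z, hz, rfl⟩ := Multiset.mem_map.1 hy
    have hz0 : z.re ≤ 0 := by
      by_contra! hlt
      exact hq z hlt (Polynomial.isRoot_of_mem_roots hz)
    simp only [Function.comp, Complex.coe_reAddGroupHom, one_div, Complex.inv_re, Complex.sub_re]
    exact div_nonneg (by linarith) (Complex.normSq_nonneg _)
  linarith

/-- The one-variable statement applies after freezing every variable except v. -/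
theorem Stable.add_pderiv {P : MvPolynomial V ℂ} (hP : Stable P) {t : ℝ} (ht : 0 < t) (v : V) :
    Stable (C (t : ℂ) * P + pderiv v P) := by
  classical
  intro s hs
  have h := add_eval_derivative_ne_zero
    (q := aeval (Function.update (fun u => Polynomial.C (s u)) v Polynomial.X) P)
    (fun x hx => ?_) ht (hs v)
  · rw [derivative_aeval_update, eval_aeval_update, eval_aeval_update,
      Function.update_eq_self] at h
    simpa using h
  · rw [eval_aeval_update]
    refine hP _ fun u => ?_
    rcases eq_or_ne u v with rfl | h
    · simpa using hx
    · simpa [Function.update_of_ne h] using hs u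

/-- The composition of the operators `t + ∂_v` over the entries `v` of a list. -/
noncomputable def shiftDeriv {R : Type*} [CommRing R] (t : R) (l : List V) (P : MvPolynomial V R) :
    MvPolynomial V R :=
  l.foldl (fun Q v => C t * Q + pderiv v Q) P

variable {R : Type*} [CommRing R]

@[simp] theorem shiftDeriv_nil (t : R) (P : MvPolynomial V R) : shiftDeriv t [] P = P := rfl

theorem shiftDeriv_linear (t a b : R) (l : List V) (P Q : MvPolynomial V R) :
    shiftDeriv t l (C a * P + C b * Q) = C a * shiftDeriv t l P + C b * shiftDeriv t l Q := by
  induction l generalizing P Q with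
  | nil => rfl
  | cons v l ih =>
    simp only [shiftDeriv, List.foldl_cons] at ih ⊢
    rw [← ih]
    congr 1
    simp only [map_add, pderiv_C_mul]
    ring

theorem shiftDeriv_cons (t : R) (v : V) (l : List V) (P : MvPolynomial V R) :
    shiftDeriv t (v :: l) P = C t * shiftDeriv t l P + shiftDeriv t l (pderiv v P) := by
  have := shiftDeriv_linear t t 1 l P (pderiv v P)
  simpa [shiftDeriv] using this

theorem Stable.shiftDeriv {P : MvPolynomial V ℂ} (hP : Stable P) {t : ℝ} (ht : 0 < t)
    (l : List V) : Stable (shiftDeriv (t : ℂ) l P) := by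
  induction l generalizing P with
  | nil => exact hP
  | cons v l ih => exact ih (hP.add_pderiv ht v)

/-- At t = 0 the operator is an iterated partial derivative; c is the product of the exponents
brought down, nonzero in characteristic zero. -/
theorem coeff_shiftDeriv_zero [CharZero R] [IsDomain R] [DecidableEq V] (l : List V) (m : V →₀ ℕ) :
    ∃ c : R, c ≠ 0 ∧ ∀ P : MvPolynomial V R,
      coeff m (shiftDeriv 0 l P) = c * coeff (m + Multiset.toFinsupp (l : Multiset V)) P := by
  induction l with
  | nil => exact ⟨1, one_ne_zero, fun P => by simp⟩
  | cons v l ih =>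
    obtain ⟨c, hc, h⟩ := ih
    refine ⟨c * ((m + Multiset.toFinsupp (l : Multiset V)) v + 1 : ℕ),
      mul_ne_zero hc (Nat.cast_ne_zero.2 (Nat.succ_ne_zero _)), fun P => ?_⟩
    rw [shiftDeriv_cons, map_zero, zero_mul, zero_add, h, coeff_pderiv]
    rw [show ((v :: l : List V) : Multiset V) = {v} + (l : Multiset V) from rfl, map_add,
      Multiset.toFinsupp_singleton]
    rw [show m + (Finsupp.single v 1 + Multiset.toFinsupp (l : Multiset V))
      = m + Multiset.toFinsupp (l : Multiset V) + Finsupp.single v 1 by abel]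
    push_cast
    ring

theorem continuous_eval_shiftDeriv (l : List V) (P : MvPolynomial V (Polynomial ℂ)) :
    Continuous fun p : ℝ × ℂ =>
      eval (fun _ => (p.1 : ℂ)) (shiftDeriv (p.1 : ℂ) l (map (Polynomial.evalRingHom p.2) P)) := by
  induction l generalizing P with
  | nil =>
    induction P using MvPolynomial.induction_on with
    | C a =>
      simp only [shiftDeriv_nil, map_C, eval_C]
      exact a.continuous.comp continuous_snd
    | add p q hp hq =>
      simp only [shiftDeriv_nil, map_add] at hp hq ⊢
      exact hp.add hq
    | mul_X p v hp =>
      simp only [shiftDeriv_nil, map_mul, map_X, eval_X] at hp ⊢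
      exact hp.mul (Complex.continuous_ofReal.comp continuous_fst)
  | cons v l ih =>
    simp only [shiftDeriv_cons, pderiv_map, map_add, map_mul, eval_C]
    exact ((Complex.continuous_ofReal.comp continuous_fst).mul (ih P)).add (ih _)

theorem differentiable_eval_shiftDeriv (l : List V) (P : MvPolynomial V (Polynomial ℂ)) (t : ℂ) :
    Differentiable ℂ fun z : ℂ =>
      eval (fun _ => t) (shiftDeriv t l (map (Polynomial.evalRingHom z) P)) := by
  induction l generalizing P with
  | nil =>
    induction P using MvPolynomial.induction_on with
    | C a =>
      simp only [shiftDeriv_nil, map_C, eval_C]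
      exact a.differentiable
    | add p q hp hq =>
      simp only [shiftDeriv_nil, map_add] at hp hq ⊢
      exact hp.add hq
    | mul_X p v hp =>
      simp only [shiftDeriv_nil, map_mul, map_X, eval_X] at hp ⊢
      exact hp.mul_const t
  | cons v l ih =>
    simp only [shiftDeriv_cons, pderiv_map, map_add, map_mul, eval_C]
    exact ((ih P).const_mul t).add (ih _)

theorem isOpen_re_pos : IsOpen {z : ℂ | 0 < z.re} := isOpen_lt continuous_const Complex.continuous_re

theorem isPreconnected_re_pos : IsPreconnected {z : ℂ | 0 < z.re} :=
  (convex_halfSpace_re_gt 0).isPreconnected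

/-- For t > 0 the operators t + ∂_v preserve stability, so the result is nonzero at the point (t, …,
t). As t ↓ 0 this value tends to a nonzero multiple of the coefficient, and Hurwitz's theorem in z
applies. -/
theorem eval_coeff_ne_zero_of_stable {P : MvPolynomial V (Polynomial ℂ)}
    (hP : ∀ z : ℂ, 0 < z.re → Stable (map (Polynomial.evalRingHom z) P)) (m : V →₀ ℕ)
    (h0 : ∃ z : ℂ, 0 < z.re ∧ (coeff m P).eval z ≠ 0) (z : ℂ) (hz : 0 < z.re) :
    (coeff m P).eval z ≠ 0 := by
  classical
  obtain ⟨c, hc, h⟩ := coeff_shiftDeriv_zero (R := ℂ) m.toMultiset.toList 0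
  have hval (z : ℂ) : eval (fun _ => ((0 : ℝ) : ℂ)) (shiftDeriv ((0 : ℝ) : ℂ) m.toMultiset.toList
      (map (Polynomial.evalRingHom z) P)) = c * (coeff m P).eval z := by
    have := h (map (Polynomial.evalRingHom z) P)
    rw [Multiset.coe_toList, Finsupp.toMultiset_toFinsupp, zero_add, coeff_map] at this
    rw [← Polynomial.coe_evalRingHom, ← this, Complex.ofReal_zero, ← constantCoeff_eq]
    exact DFunLike.congr_fun eval_zero' _
  have key := ne_zero_of_tendsto_of_ne_zero (l := 𝓝[>] (0 : ℝ)) isOpen_re_pos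
    isPreconnected_re_pos
    (F := fun (t : ℝ) z => eval (fun _ => (t : ℂ)) (shiftDeriv (t : ℂ) m.toMultiset.toList
      (map (Polynomial.evalRingHom z) P)))
    (f := fun z => c * (coeff m P).eval z)
    (Eventually.of_forall fun t => (differentiable_eval_shiftDeriv _ P _).differentiableOn)
    ?_ ((Polynomial.differentiable _).const_mul c).differentiableOn ?_ ?_
  · exact right_ne_zero_of_mul (key z hz)
  · filter_upwards [self_mem_nhdsWithin] with t ht z hz
    exact (hP z hz).shiftDeriv ht _ _ fun _ => by simpa using ht
  · intro z _
    rw [← hval]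
    have := (continuous_eval_shiftDeriv m.toMultiset.toList P).tendsto (0, z)
    rw [nhds_prod_eq] at this
    exact this.mono_left (prod_mono nhdsWithin_le_nhds le_rfl)
  · obtain ⟨z, hz, h⟩ := h0
    exact ⟨z, hz, mul_ne_zero hc h⟩

end Stability

/-! ### The Jacobi triple product -/

section TripleProduct

/-- The reciprocal of `∏_{i=1}^m (1 - p^i)`, extended by zero to negative `m`. -/
noncomputable def qFactorialInv (p : ℝ) (m : ℤ) : ℝ :=
  if m < 0 then 0 else (∏ i ∈ Finset.range m.toNat, (1 - p ^ (i + 1)))⁻¹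

variable {p : ℝ}

theorem qFactorialInv_natCast (p : ℝ) (m : ℕ) :
    qFactorialInv p m = (∏ i ∈ Finset.range m, (1 - p ^ (i + 1)))⁻¹ := by
  simp [qFactorialInv]

theorem qFactorialInv_of_neg (p : ℝ) {m : ℤ} (hm : m < 0) : qFactorialInv p m = 0 := by
  simp [qFactorialInv, hm]

theorem one_sub_pow_pos (hp0 : 0 ≤ p) (hp1 : p < 1) (i : ℕ) : 0 < 1 - p ^ (i + 1) :=
  sub_pos.2 (pow_lt_one₀ hp0 hp1 i.succ_ne_zero)

/-- Extension by zero makes the recurrence valid for all integers: at m = 0 the factor 1 - p^0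
vanishes. -/
theorem qFactorialInv_sub_one (hp0 : 0 ≤ p) (hp1 : p < 1) (m : ℤ) :
    qFactorialInv p (m - 1) = (1 - p ^ m) * qFactorialInv p m := by
  rcases lt_or_ge m 0 with hm | hm
  · rw [qFactorialInv_of_neg p hm, qFactorialInv_of_neg p (by lia), mul_zero]
  · obtain ⟨k, rfl⟩ := Int.eq_ofNat_of_zero_le hm
    cases k with
    | zero => simp [qFactorialInv]
    | succ k =>
      rw [show ((k + 1 : ℕ) : ℤ) - 1 = (k : ℕ) by push_cast; ring, qFactorialInv_natCast,
        qFactorialInv_natCast, Finset.prod_range_succ, zpow_natCast]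
      have := (one_sub_pow_pos hp0 hp1 k).ne'
      rw [mul_inv, mul_comm (_⁻¹), ← mul_assoc, mul_inv_cancel₀ this, one_mul]

theorem qFactorialInv_nonneg (hp0 : 0 ≤ p) (hp1 : p < 1) (m : ℤ) : 0 ≤ qFactorialInv p m := by
  unfold qFactorialInv
  split_ifs
  · exact le_rfl
  · exact inv_nonneg.2 (Finset.prod_nonneg fun i _ => (one_sub_pow_pos hp0 hp1 i).le)

theorem qFactorialInv_le (hp0 : 0 ≤ p) (hp1 : p < 1) (m : ℤ) :
    qFactorialInv p m ≤ Real.exp ((1 - p)⁻¹ * (1 - p)⁻¹) := by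
  have hp : 0 < 1 - p := sub_pos.2 hp1
  unfold qFactorialInv
  split_ifs
  · positivity
  · rw [← Finset.prod_inv_distrib]
    calc ∏ i ∈ Finset.range m.toNat, (1 - p ^ (i + 1))⁻¹
        -- Each factor satisfies 1/(1 - p^(i+1)) ≤ 1 + p^i/(1 - p), and the exponents then sum to at
        -- most (1 - p)⁻².
        ≤ ∏ i ∈ Finset.range m.toNat, Real.exp ((1 - p)⁻¹ * p ^ i) := by
          refine Finset.prod_le_prod
            (fun i _ => (inv_pos.2 (one_sub_pow_pos hp0 hp1 i)).le) fun i _ => ?_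
          refine le_trans ?_ (Real.add_one_le_exp _)
          have h1 := one_sub_pow_pos hp0 hp1 i
          have h2 : p ^ (i + 1) ≤ p := pow_le_of_le_one hp0 hp1.le i.succ_ne_zero
          have h3 : p ^ (i + 1) ≤ p ^ i := pow_le_pow_of_le_one hp0 hp1.le i.le_succ
          have h4 : 0 ≤ p ^ i := pow_nonneg hp0 i
          rw [inv_le_iff_one_le_mul₀ h1]
          have h5 : 1 ≤ (1 - p)⁻¹ * (1 - p ^ (i + 1)) := by
            rw [inv_mul_eq_div, one_le_div hp]; linarith
          nlinarith
      _ = Real.exp ((1 - p)⁻¹ * ∑ i ∈ Finset.range m.toNat, p ^ i) := by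
          rw [← Real.exp_sum, Finset.mul_sum]
      _ ≤ _ := by
          refine Real.exp_le_exp.2 (mul_le_mul_of_nonneg_left ?_ (inv_nonneg.2 hp.le))
          rw [← tsum_geometric_of_lt_one hp0 hp1]
          exact (summable_geometric_of_lt_one hp0 hp1).sum_le_tsum _ fun i _ => pow_nonneg hp0 i

theorem exists_tendsto_qFactorialInv (hp0 : 0 ≤ p) (hp1 : p < 1) :
    ∃ L : ℝ, 0 < L ∧ Tendsto (fun m : ℤ => qFactorialInv p m) atTop (𝓝 L) := by
  have hmono : Monotone (fun m : ℤ => qFactorialInv p m) := by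
    refine monotone_int_of_le_succ fun m => ?_
    have h := qFactorialInv_sub_one hp0 hp1 (m + 1)
    rw [add_sub_cancel_right] at h
    rw [h]
    rcases lt_or_ge (m + 1) 0 with hm | hm
    · rw [qFactorialInv_of_neg p hm, mul_zero]
    · exact mul_le_of_le_one_left (qFactorialInv_nonneg hp0 hp1 _)
        (by have := zpow_nonneg hp0 (m + 1); linarith)
  have hbdd : BddAbove (Set.range fun m : ℤ => qFactorialInv p m) :=
    ⟨_, Set.forall_mem_range.2 (qFactorialInv_le hp0 hp1)⟩
  refine ⟨_, ?_, tendsto_atTop_ciSup hmono hbdd⟩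
  have h0 : qFactorialInv p 0 = 1 := by simp [qFactorialInv]
  exact (h0 ▸ zero_lt_one).trans_le (le_ciSup hbdd 0)

/-- The coefficient of `x ^ k` in `∏_{j < n} (1 + q^(2j+1) x) (1 + q^(2j+1) / x)`, up to the factor
`q ^ (k ^ 2)`: a Gaussian binomial coefficient. -/
noncomputable def centralQBinomial (p : ℝ) (n : ℕ) (k : ℤ) : ℝ :=
  (∏ i ∈ Finset.range (2 * n), (1 - p ^ (i + 1))) *
    (qFactorialInv p (n + k) * qFactorialInv p (n - k))

/-- This compares coefficients of x^k after multiplying by (1 + Qx)(1 + Q/x) = 1 + Q² + Qx + Q/x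
with Q = q^(2n+1). -/
theorem centralQBinomial_succ {q : ℝ} (hq0 : 0 < q) (hq1 : q < 1) (n : ℕ) (k : ℤ) :
    centralQBinomial (q ^ 2) (n + 1) k * q ^ (k ^ 2) =
      (1 + q ^ (2 * n + 1) * q ^ (2 * n + 1)) * (centralQBinomial (q ^ 2) n k * q ^ (k ^ 2)) +
      q ^ (2 * n + 1) * (centralQBinomial (q ^ 2) n (k - 1) * q ^ ((k - 1) ^ 2)) +
      q ^ (2 * n + 1) * (centralQBinomial (q ^ 2) n (k + 1) * q ^ ((k + 1) ^ 2)) := by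
  have hp0 : 0 ≤ q ^ 2 := by positivity
  have hp1 : q ^ 2 < 1 := pow_lt_one₀ hq0.le hq1 two_ne_zero
  have hr := qFactorialInv_sub_one hp0 hp1
  have hq : q ≠ 0 := hq0.ne'
  -- All reciprocals are reduced to those at n+1+k and n+1-k; what remains is an algebraic identity
  -- in q, q^n and q^k.
  have e1 : qFactorialInv (q ^ 2) (n + k) =
      (1 - (q ^ 2) ^ (n + 1 + k : ℤ)) * qFactorialInv (q ^ 2) (n + 1 + k) := by
    rw [← hr]; congr 1; ring
  have e2 : qFactorialInv (q ^ 2) (n - k) =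
      (1 - (q ^ 2) ^ (n + 1 - k : ℤ)) * qFactorialInv (q ^ 2) (n + 1 - k) := by
    rw [← hr]; congr 1; ring
  have e3 : qFactorialInv (q ^ 2) (n + (k - 1)) =
      (1 - (q ^ 2) ^ (n + k : ℤ)) * qFactorialInv (q ^ 2) (n + k) := by
    rw [← hr]; congr 1; ring
  have e4 : qFactorialInv (q ^ 2) (n - (k + 1)) =
      (1 - (q ^ 2) ^ (n - k : ℤ)) * qFactorialInv (q ^ 2) (n - k) := by
    rw [← hr]; congr 1; ring
  have e5 : qFactorialInv (q ^ 2) (n - (k - 1)) = qFactorialInv (q ^ 2) (n + 1 - k) := by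
    congr 1; ring
  have e6 : qFactorialInv (q ^ 2) (n + (k + 1)) = qFactorialInv (q ^ 2) (n + 1 + k) := by
    congr 1; ring
  have hz (m : ℤ) : (q ^ 2) ^ m = q ^ m * q ^ m := by
    rw [← mul_zpow, sq]
  have hk1 : q ^ ((k - 1) ^ 2) = q ^ (k ^ 2) * ((q ^ k)⁻¹ * (q ^ k)⁻¹ * q) := by
    rw [← zpow_neg, ← zpow_add₀ hq, ← zpow_add_one₀ hq, ← zpow_add₀ hq]; congr 1; ring
  have hk2 : q ^ ((k + 1) ^ 2) = q ^ (k ^ 2) * (q ^ k * q ^ k * q) := by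
    rw [← zpow_add₀ hq, ← zpow_add_one₀ hq, ← zpow_add₀ hq]; congr 1; ring
  unfold centralQBinomial
  rw [show 2 * (n + 1) = 2 * n + 1 + 1 by ring, Finset.prod_range_succ, Finset.prod_range_succ]
  push_cast
  rw [e3, e4, e5, e6, e1, e2, hk1, hk2]
  simp only [hz, zpow_add₀ hq, zpow_sub₀ hq, zpow_natCast, zpow_one]
  have hκ : q ^ k ≠ 0 := zpow_ne_zero k hq
  generalize q ^ k = κ at hκ ⊢
  generalize q ^ (k ^ 2) = ρ
  generalize qFactorialInv (q ^ 2) (n + 1 + k) = A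
  generalize qFactorialInv (q ^ 2) (n + 1 - k) = B
  generalize ∏ i ∈ Finset.range (2 * n), (1 - (q ^ 2) ^ (i + 1)) = D
  have hn : q ^ (2 * n + 1) = q ^ n * q ^ n * q := by ring
  have hn1 : (q ^ 2) ^ (2 * n + 1) = (q ^ n) ^ 4 * q ^ 2 := by ring
  have hn2 : (q ^ 2) ^ (2 * n + 1 + 1) = (q ^ n) ^ 4 * q ^ 4 := by ring
  rw [hn, hn1, hn2]
  generalize q ^ n = P
  field_simp
  ring

theorem hasSum_centralQBinomial {q : ℝ} (hq0 : 0 < q) (hq1 : q < 1) {x : ℂ} (hx : x ≠ 0) (n : ℕ) :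
    HasSum (fun k : ℤ => ((centralQBinomial (q ^ 2) n k * q ^ (k ^ 2) : ℝ) : ℂ) * x ^ k)
      (∏ j ∈ Finset.range n,
        ((1 + ((q ^ (2 * j + 1) : ℝ) : ℂ) * x) * (1 + ((q ^ (2 * j + 1) : ℝ) : ℂ) * x⁻¹))) := by
  induction n with
  | zero =>
    have h := hasSum_single (f := fun k : ℤ =>
      ((centralQBinomial (q ^ 2) 0 k * q ^ (k ^ 2) : ℝ) : ℂ) * x ^ k) 0 ?_
    · simpa [centralQBinomial, qFactorialInv] using h
    · intro k hk
      have : centralQBinomial (q ^ 2) 0 k = 0 := by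
        rcases lt_or_gt_of_ne hk with h | h
        · simp [centralQBinomial, qFactorialInv_of_neg _ h]
        · simp [centralQBinomial, qFactorialInv_of_neg _ (neg_neg_of_pos h)]
      simp [this]
  | succ n ih =>
    rw [Finset.prod_range_succ]
    set Q : ℂ := ((q ^ (2 * n + 1) : ℝ) : ℂ) with hQ
    set S := ∏ j ∈ Finset.range n,
      ((1 + ((q ^ (2 * j + 1) : ℝ) : ℂ) * x) * (1 + ((q ^ (2 * j + 1) : ℝ) : ℂ) * x⁻¹))
    have h1 := ih.mul_left (1 + Q * Q)
    have h2 := ((Equiv.subRight (1 : ℤ)).hasSum_iff.2 ih).mul_left (Q * x)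
    have h3 := ((Equiv.addRight (1 : ℤ)).hasSum_iff.2 ih).mul_left (Q * x⁻¹)
    have h := (h1.add h2).add h3
    have hS : (1 + Q * Q) * S + Q * x * S + Q * x⁻¹ * S
        = S * ((1 + Q * x) * (1 + Q * x⁻¹)) := by
      have : Q * x * (Q * x⁻¹) = Q * Q := by
        rw [mul_mul_mul_comm, mul_inv_cancel₀ hx, mul_one]
      linear_combination (-S) * this
    rw [hS] at h
    convert! h using 1
    funext k
    rw [centralQBinomial_succ hq0 hq1 n k]
    simp only [Function.comp, Equiv.subRight_apply, Equiv.coe_addRight]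
    rw [zpow_sub₀ hx, zpow_add₀ hx, zpow_one, hQ]
    push_cast
    field_simp

theorem centralQBinomial_nonneg (hp0 : 0 ≤ p) (hp1 : p < 1) (n : ℕ) (k : ℤ) :
    0 ≤ centralQBinomial p n k :=
  mul_nonneg (Finset.prod_nonneg fun i _ => (one_sub_pow_pos hp0 hp1 i).le)
    (mul_nonneg (qFactorialInv_nonneg hp0 hp1 _) (qFactorialInv_nonneg hp0 hp1 _))

theorem centralQBinomial_le (hp0 : 0 ≤ p) (hp1 : p < 1) (n : ℕ) (k : ℤ) :
    centralQBinomial p n k ≤ Real.exp ((1 - p)⁻¹ * (1 - p)⁻¹) ^ 2 := by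
  have h1 : ∏ i ∈ Finset.range (2 * n), (1 - p ^ (i + 1)) ≤ 1 :=
    Finset.prod_le_one (fun i _ => (one_sub_pow_pos hp0 hp1 i).le)
      fun i _ => by have := pow_nonneg hp0 (i + 1); linarith
  have hnn := qFactorialInv_nonneg hp0 hp1
  refine (mul_le_of_le_one_left (mul_nonneg (hnn _) (hnn _)) h1).trans ?_
  rw [sq]
  exact mul_le_mul (qFactorialInv_le hp0 hp1 _) (qFactorialInv_le hp0 hp1 _) (hnn _)
    (Real.exp_nonneg _)

/-- The limit does not depend on k, so in the limit only the theta coefficients q^(k²) remain. -/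
theorem exists_tendsto_centralQBinomial (hp0 : 0 ≤ p) (hp1 : p < 1) :
    ∃ L : ℝ, 0 < L ∧ ∀ k, Tendsto (fun n => centralQBinomial p n k) atTop (𝓝 L) := by
  obtain ⟨L, hL, h⟩ := exists_tendsto_qFactorialInv hp0 hp1
  refine ⟨L⁻¹ * (L * L), by positivity, fun k => ?_⟩
  have hcast : Tendsto (fun n : ℕ => (n : ℤ)) atTop atTop := tendsto_natCast_atTop_atTop
  refine Tendsto.mul ?_ ((h.comp (tendsto_atTop_add_const_right _ k hcast)).mul
    (h.comp (tendsto_atTop_add_const_right _ (-k) hcast)))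
  have h2 : Tendsto (fun n : ℕ => ((2 * n : ℕ) : ℤ)) atTop atTop :=
    hcast.comp (tendsto_id.const_mul_atTop' two_pos)
  refine ((h.comp h2).inv₀ hL.ne').congr fun n => ?_
  rw [Function.comp, qFactorialInv_natCast, inv_inv]

/-- A form of the **Jacobi triple product identity**, with an unspecified constant. -/
theorem exists_tendsto_prod_theta {q : ℝ} (hq0 : 0 < q) (hq1 : q < 1)
    (hs : Summable fun k : ℤ => q ^ (k ^ 2)) :
    ∃ L K : ℝ, 0 < L ∧ ∀ x : ℂ, ‖x‖ = 1 →
      Tendsto (fun n => ∏ j ∈ Finset.range n,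
        ((1 + ((q ^ (2 * j + 1) : ℝ) : ℂ) * x) * (1 + ((q ^ (2 * j + 1) : ℝ) : ℂ) * x⁻¹)))
        atTop (𝓝 (L * ∑' k : ℤ, ((q ^ (k ^ 2) : ℝ) : ℂ) * x ^ k)) ∧
      ∀ n, ‖∏ j ∈ Finset.range n,
        ((1 + ((q ^ (2 * j + 1) : ℝ) : ℂ) * x) * (1 + ((q ^ (2 * j + 1) : ℝ) : ℂ) * x⁻¹))‖ ≤ K := by
  have hp0 : 0 ≤ q ^ 2 := by positivity
  have hp1 : q ^ 2 < 1 := pow_lt_one₀ hq0.le hq1 two_ne_zero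
  obtain ⟨L, hL, hlim⟩ := exists_tendsto_centralQBinomial hp0 hp1
  set M := Real.exp ((1 - q ^ 2)⁻¹ * (1 - q ^ 2)⁻¹) ^ 2
  have hsum : Summable fun k : ℤ => M * q ^ (k ^ 2) := hs.mul_left M
  refine ⟨L, ∑' k : ℤ, M * q ^ (k ^ 2), hL, fun x hx => ?_⟩
  have hx0 : x ≠ 0 := by rintro rfl; simp at hx
  have hbound (n : ℕ) (k : ℤ) :
      ‖((centralQBinomial (q ^ 2) n k * q ^ (k ^ 2) : ℝ) : ℂ) * x ^ k‖ ≤ M * q ^ (k ^ 2) := by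
    have hz : 0 ≤ q ^ (k ^ 2) := zpow_nonneg hq0.le _
    rw [norm_mul, norm_zpow, hx, one_zpow, mul_one, Complex.norm_real, Real.norm_of_nonneg
      (mul_nonneg (centralQBinomial_nonneg hp0 hp1 n k) hz)]
    exact mul_le_mul_of_nonneg_right (centralQBinomial_le hp0 hp1 n k) hz
  constructor
  · rw [← tsum_mul_left]
    simp_rw [← (hasSum_centralQBinomial hq0 hq1 hx0 _).tsum_eq]
    -- On the unit circle the terms are dominated by M q^(k²), uniformly in n.
    refine tendsto_tsum_of_dominated_convergence hsum (fun k => ?_)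
      (Eventually.of_forall fun n k => hbound n k)
    rw [← mul_assoc, ← Complex.ofReal_mul]
    exact ((Complex.continuous_ofReal.tendsto _).comp ((hlim k).mul_const _)).mul_const _
  · intro n
    rw [← (hasSum_centralQBinomial hq0 hq1 hx0 n).tsum_eq]
    exact tsum_of_norm_bounded hsum.hasSum (hbound n)

end TripleProduct

/-! ### Edge weights as limits of products -/

section EdgeWeight

theorem exp_zpow (a : ℝ) (k : ℤ) : Real.exp a ^ k = Real.exp (k * a) := by
  rw [mul_comm, Real.exp_mul, Real.rpow_intCast]

theorem summable_exp_neg_quadratic {a : ℝ} (ha : 0 < a) (b : ℝ) :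
    Summable fun k : ℤ => Real.exp (-a * (k : ℝ) ^ 2 + b * k) := by
  have hπ := Real.pi_pos
  have h := (summable_jacobiTheta₂_term_iff ((-(b / (2 * Real.pi)) : ℝ) * Complex.I)
    ((a / Real.pi : ℝ) * Complex.I)).2 (by simpa using by positivity)
  refine h.norm.congr fun k => ?_
  rw [jacobiTheta₂_term, Complex.norm_exp]
  congr 1
  have e : 2 * (Real.pi : ℂ) * Complex.I * k * ((-(b / (2 * Real.pi)) : ℝ) * Complex.I)
      + Real.pi * Complex.I * (k : ℂ) ^ 2 * ((a / Real.pi : ℝ) * Complex.I)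
      = ((-a * (k : ℝ) ^ 2 + b * k : ℝ) : ℂ) := by
    have hπ' : (Real.pi : ℂ) ≠ 0 := by exact_mod_cast hπ.ne'
    push_cast
    field_simp
    rw [Complex.I_sq]
    ring
  rw [e, Complex.ofReal_re]

theorem summable_edgeWeight {J : ℝ} (hJ : 0 < J) (θ : ℝ) :
    Summable fun m : ℤ => Real.exp (-(J / 2) * (θ + 2 * Real.pi * m) ^ 2) := by
  have := (summable_exp_neg_quadratic (a := 2 * Real.pi ^ 2 * J) (by positivity)
    (-(2 * Real.pi * J * θ))).mul_left (Real.exp (-(J / 2) * θ ^ 2))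
  refine this.congr fun m => ?_
  rw [← Real.exp_add]
  congr 1
  ring

theorem edgeWeight_pos {J : ℝ} (hJ : 0 ≤ J) (θ : ℝ) : 0 < edgeWeight J θ := by
  unfold edgeWeight
  split_ifs with h
  · exact one_pos
  · exact (summable_edgeWeight (lt_of_le_of_ne hJ (Ne.symm h)) θ).tsum_pos
      (fun m => (Real.exp_pos _).le) 0 (Real.exp_pos _)

/-- Poisson summation for the periodized Gaussian. -/
theorem tsum_theta_eq_edgeWeight {J : ℝ} (hJ : 0 < J) (θ : ℝ) :
    ∑' k : ℤ, ((Real.exp (-(1 / (2 * J))) ^ (k ^ 2) : ℝ) : ℂ) * Complex.exp (θ * Complex.I) ^ k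
      = (((1 / (2 * Real.pi * J)) ^ (-(1 / 2) : ℝ) * edgeWeight J θ : ℝ) : ℂ) := by
  have hπ := Real.pi_pos
  have ha : 0 < 1 / (2 * Real.pi * J) := by positivity
  have h := Complex.tsum_exp_neg_quadratic (a := ((1 / (2 * Real.pi * J) : ℝ) : ℂ))
    (by rwa [Complex.ofReal_re]) (θ / (2 * Real.pi) * Complex.I)
  have hpi : (Real.pi : ℂ) ≠ 0 := by exact_mod_cast hπ.ne'
  have hJ' : (J : ℂ) ≠ 0 := by exact_mod_cast hJ.ne'
  calc _ = ∑' n : ℤ, Complex.exp (-Real.pi * ((1 / (2 * Real.pi * J) : ℝ) : ℂ) * n ^ 2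
            + 2 * Real.pi * (θ / (2 * Real.pi) * Complex.I) * n) := by
          refine tsum_congr fun n => ?_
          rw [exp_zpow, Complex.ofReal_exp, ← Complex.exp_int_mul, ← Complex.exp_add]
          congr 1
          push_cast
          field_simp
    _ = _ := by
          -- Poisson summation yields Gaussians centred at θ + 2πℤ in the form (2πn - θ)², hence the
          -- passage to -θ.
          rw [h, ← edgeWeight_neg, edgeWeight, if_neg hJ.ne', Complex.ofReal_mul,
            Complex.ofReal_tsum, Real.rpow_neg ha.le, Complex.ofReal_inv,
            Complex.ofReal_cpow ha.le, one_div (_ ^ _)]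
          congr 1
          · norm_num
          · refine tsum_congr fun n => ?_
            rw [Complex.ofReal_exp]
            congr 1
            push_cast
            have hI : Complex.I * (θ / (2 * Real.pi) * Complex.I) = -(θ / (2 * Real.pi)) := by
              linear_combination (θ / (2 * Real.pi)) * Complex.I_mul_I
            rw [hI]
            field_simp
            ring

/-- The finite product approximating an edge weight. -/
noncomputable def thetaProd (q : ℝ) (n : ℕ) (θ : ℝ) : ℂ :=
  ∏ j ∈ Finset.range n,
    ((1 + ((q ^ (2 * j + 1) : ℝ) : ℂ) * Complex.exp (θ * Complex.I)) *
      (1 + ((q ^ (2 * j + 1) : ℝ) : ℂ) * (Complex.exp (θ * Complex.I))⁻¹))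

theorem exists_tendsto_thetaProd {J : ℝ} (hJ : 0 ≤ J) :
    ∃ q L K : ℝ, 0 ≤ q ∧ 0 < L ∧ ∀ θ : ℝ,
      Tendsto (fun n => thetaProd q n θ) atTop (𝓝 ((L * edgeWeight J θ : ℝ) : ℂ)) ∧
      ∀ n, ‖thetaProd q n θ‖ ≤ K := by
  rcases hJ.eq_or_lt with rfl | hJ
  -- For J = 0 the choice q = 0 makes every factor 1, matching the constant weight.
  · exact ⟨0, 1, 1, le_rfl, one_pos, fun θ => by simp [thetaProd, edgeWeight]⟩
  · have hq1 : Real.exp (-(1 / (2 * J))) < 1 := Real.exp_lt_one_iff.2 (by simpa using by positivity)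
    have hs : Summable fun k : ℤ => Real.exp (-(1 / (2 * J))) ^ (k ^ 2) := by
      refine (summable_exp_neg_quadratic (a := 1 / (2 * J)) (by positivity) 0).congr fun k => ?_
      rw [exp_zpow]
      congr 1
      push_cast
      ring
    obtain ⟨L, K, hL, h⟩ := exists_tendsto_prod_theta (Real.exp_pos _) hq1 hs
    refine ⟨Real.exp (-(1 / (2 * J))), L * (1 / (2 * Real.pi * J)) ^ (-(1 / 2) : ℝ), K,
      (Real.exp_pos _).le, by have := Real.pi_pos; positivity, fun θ => ?_⟩
    obtain ⟨h1, h2⟩ := h _ (Complex.norm_exp_ofReal_mul_I θ)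
    rw [tsum_theta_eq_edgeWeight hJ, ← Complex.ofReal_mul, ← mul_assoc] at h1
    exact ⟨h1, h2⟩

end EdgeWeight

/-! ### Torus integrals as coefficients of stable polynomials -/

section ConstantTerm

open MvPolynomial

variable {V : Type*} [Fintype V]

/-- The uniform measure on `(-π, π]^V`, of total mass `(2π)^|V|`. -/
noncomputable abbrev torusMeasure (V : Type*) [Fintype V] : Measure (V → ℝ) :=
  Measure.pi fun _ : V => (volume : Measure ℝ).restrict (Set.Ioc (-Real.pi) Real.pi)

theorem integral_exp_mul_inv_exp_pow (α : ℝ) (k m : ℕ) :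
    ∫ θ in Set.Ioc (-Real.pi) Real.pi, Complex.exp ((θ + α : ℝ) * Complex.I) ^ k *
      (Complex.exp ((θ + α : ℝ) * Complex.I))⁻¹ ^ m = if k = m then (2 * Real.pi : ℂ) else 0 := by
  rw [← intervalIntegral.integral_of_le (by linarith [Real.pi_pos])]
  split_ifs with h
  · subst h
    simp_rw [← mul_pow, mul_inv_cancel₀ (Complex.exp_ne_zero _), one_pow]
    rw [intervalIntegral.integral_const]
    simp
    ring
  · have hc : (((k : ℤ) - m : ℤ) : ℂ) * Complex.I ≠ 0 :=
      mul_ne_zero (Int.cast_ne_zero.2 (by lia)) Complex.I_ne_zero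
    have hrw (θ : ℝ) : Complex.exp ((θ + α : ℝ) * Complex.I) ^ k *
        (Complex.exp ((θ + α : ℝ) * Complex.I))⁻¹ ^ m
        = Complex.exp ((((k : ℤ) - m : ℤ) : ℂ) * Complex.I * α) *
          Complex.exp ((((k : ℤ) - m : ℤ) : ℂ) * Complex.I * θ) := by
      rw [← Complex.exp_neg, ← Complex.exp_nat_mul, ← Complex.exp_nat_mul, ← Complex.exp_add,
        ← Complex.exp_add]
      congr 1
      push_cast
      ring
    simp_rw [hrw]
    rw [intervalIntegral.integral_const_mul, integral_exp_mul_complex hc]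
    have hper : Complex.exp ((((k : ℤ) - m : ℤ) : ℂ) * Complex.I * (Real.pi : ℝ))
        = Complex.exp ((((k : ℤ) - m : ℤ) : ℂ) * Complex.I * ((-Real.pi : ℝ) : ℂ)) := by
      rw [Complex.exp_eq_exp_iff_exists_int]
      exact ⟨(k : ℤ) - m, by push_cast; ring⟩
    rw [hper, sub_self, zero_div, mul_zero]

theorem continuous_eval_exp_mul (P : MvPolynomial V ℂ) (m : V →₀ ℕ) (α : ℝ) :
    Continuous fun θ : V → ℝ => eval (fun v => Complex.exp ((θ v + α : ℝ) * Complex.I)) P *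
      ∏ v, (Complex.exp ((θ v + α : ℝ) * Complex.I))⁻¹ ^ m v := by
  refine Continuous.mul ?_ ?_
  · exact (MvPolynomial.continuous_eval P).comp (by fun_prop)
  · simp_rw [← Complex.exp_neg]
    fun_prop

instance : IsFiniteMeasure (torusMeasure V) := by
  unfold torusMeasure; infer_instance

theorem ae_mem_Icc_torusMeasure :
    ∀ᵐ θ ∂(torusMeasure V), θ ∈ Set.Icc (fun _ : V => -Real.pi) (fun _ => Real.pi) := by
  have h : ∀ v : V, ∀ᵐ θ ∂(torusMeasure V), θ v ∈ Set.Ioc (-Real.pi) Real.pi := fun v =>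
    Measure.tendsto_eval_ae_ae.eventually (ae_restrict_mem measurableSet_Ioc)
  filter_upwards [ae_all_iff.2 h] with θ hθ
  exact ⟨fun v => (hθ v).1.le, fun v => (hθ v).2⟩

theorem integrable_torusMeasure_of_continuous {g : (V → ℝ) → ℂ} (hg : Continuous g) :
    Integrable g (torusMeasure V) := by
  obtain ⟨K, hK⟩ := (isCompact_Icc (a := fun _ : V => -Real.pi)
    (b := fun _ => Real.pi)).exists_bound_of_continuousOn hg.continuousOn
  refine Integrable.of_bound hg.aestronglyMeasurable K ?_
  filter_upwards [ae_mem_Icc_torusMeasure] with θ hθ using hK θ hθ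

/-- Fourier orthogonality in each variable. The value is independent of α, which later gives
invariance under θ ↦ θ + π without a change of variables. -/
theorem integral_eval_exp_mul (P : MvPolynomial V ℂ) (m : V →₀ ℕ) (α : ℝ) :
    ∫ θ, eval (fun v => Complex.exp ((θ v + α : ℝ) * Complex.I)) P *
      ∏ v, (Complex.exp ((θ v + α : ℝ) * Complex.I))⁻¹ ^ m v ∂(torusMeasure V)
      = (2 * Real.pi) ^ Fintype.card V * coeff m P := by
  classical
  induction P using MvPolynomial.induction_on' with
  | add p q hp hq =>
    simp_rw [map_add, add_mul]
    rw [integral_add (integrable_torusMeasure_of_continuous (continuous_eval_exp_mul p m α))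
      (integrable_torusMeasure_of_continuous (continuous_eval_exp_mul q m α)), hp, hq, coeff_add,
      mul_add]
  | monomial k a =>
    have hrw (θ : V → ℝ) : eval (fun v => Complex.exp ((θ v + α : ℝ) * Complex.I)) (monomial k a) *
        ∏ v, (Complex.exp ((θ v + α : ℝ) * Complex.I))⁻¹ ^ m v
        = a * ∏ v, (Complex.exp ((θ v + α : ℝ) * Complex.I) ^ k v *
          (Complex.exp ((θ v + α : ℝ) * Complex.I))⁻¹ ^ m v) := by
      rw [eval_monomial, Finsupp.prod_fintype _ _ (by simp), mul_assoc, Finset.prod_mul_distrib]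
    simp_rw [hrw]
    rw [integral_const_mul, integral_fintype_prod_eq_prod (𝕜 := ℂ) (fun v (x : ℝ) =>
      Complex.exp ((x + α : ℝ) * Complex.I) ^ k v *
          (Complex.exp ((x + α : ℝ) * Complex.I))⁻¹ ^ m v)]
    simp_rw [integral_exp_mul_inv_exp_pow]
    rw [coeff_monomial]
    split_ifs with h
    · subst h
      simp [mul_comm]
    · obtain ⟨v, hv⟩ := DFunLike.ne_iff.1 h
      rw [Finset.prod_eq_zero (Finset.mem_univ v) (if_neg hv), mul_zero, mul_zero]

/-- A function of `z` and of the angles `θ_v` that is a Laurent polynomial in the `exp (i θ_v)` with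
coefficients polynomial in `z`, whose numerator has no zeros when `z` and all the variables
replacing the `exp (i θ_v)` lie in the open right half plane. -/
def TrigStable (g : ℂ → (V → ℝ) → ℂ) : Prop :=
  ∃ (P : MvPolynomial V (Polynomial ℂ)) (m : V →₀ ℕ),
    (∀ z : ℂ, 0 < z.re → Stable (map (Polynomial.evalRingHom z) P)) ∧
    ∀ z θ, g z θ = eval (fun v => Complex.exp ((θ v : ℝ) * Complex.I))
      (map (Polynomial.evalRingHom z) P) * ∏ v, (Complex.exp ((θ v : ℝ) * Complex.I))⁻¹ ^ m v

theorem TrigStable.one : TrigStable (fun _ (_ : V → ℝ) => 1) :=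
  ⟨1, 0, fun z _ s _ => by simp, fun z θ => by simp⟩

theorem TrigStable.mul {g h : ℂ → (V → ℝ) → ℂ} (hg : TrigStable g) (hh : TrigStable h) :
    TrigStable (fun z θ => g z θ * h z θ) := by
  obtain ⟨P, m, hP, hg⟩ := hg
  obtain ⟨Q, k, hQ, hh⟩ := hh
  refine ⟨P * Q, m + k, fun z hz => ?_, fun z θ => ?_⟩
  · rw [map_mul]
    exact (hP z hz).mul (hQ z hz)
  · simp only [hg, hh, map_mul, Finsupp.add_apply, pow_add, Finset.prod_mul_distrib]
    ring

theorem TrigStable.prod {ι : Type*} (s : Finset ι) {g : ι → ℂ → (V → ℝ) → ℂ}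
    (hg : ∀ i, TrigStable (g i)) : TrigStable (fun z θ => ∏ i ∈ s, g i z θ) := by
  classical
  induction s using Finset.induction_on with
  | empty => simpa using TrigStable.one
  | insert i s hi ih =>
    simp only [Finset.prod_insert hi]
    exact (hg i).mul ih

theorem TrigStable.pow {g : ℂ → (V → ℝ) → ℂ} (hg : TrigStable g) (n : ℕ) :
    TrigStable (fun z θ => g z θ ^ n) := by
  simpa using TrigStable.prod (Finset.range n) fun _ => hg

theorem prod_pow_single [DecidableEq V] (f : V → ℂ) (v : V) :
    ∏ u, f u ^ (Finsupp.single v 1 u) = f v := by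
  rw [Finset.prod_eq_single v]
  · simp
  · intro u _ hu
    rw [Finsupp.single_eq_of_ne hu, pow_zero]
  · simp

theorem TrigStable.one_add_exp_sub {c : ℝ} (hc : 0 ≤ c) (u v : V) :
    TrigStable (fun _ (θ : V → ℝ) => 1 + (c : ℂ) *
      (Complex.exp (θ u * Complex.I) * (Complex.exp (θ v * Complex.I))⁻¹)) := by
  classical
  refine ⟨X v + C (Polynomial.C (c : ℂ)) * X u, Finsupp.single v 1, fun z hz s hs h => ?_,
    fun z θ => ?_⟩
  · have h := congrArg Complex.re h
    simp at h
    have := mul_nonneg hc (hs u).le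
    have := hs v
    linarith
  · rw [prod_pow_single (fun v => (Complex.exp (θ v * Complex.I))⁻¹)]
    have := Complex.exp_ne_zero (θ v * Complex.I)
    simp
    field_simp

theorem TrigStable.one_add_mul_exp {c : ℝ} (hc : 0 ≤ c) (v : V) :
    TrigStable (fun z (θ : V → ℝ) => 1 + (c : ℂ) * z * Complex.exp (θ v * Complex.I)) := by
  refine ⟨1 + C (Polynomial.C (c : ℂ) * Polynomial.X) * X v, 0, fun z hz s hs h => ?_,
    fun z θ => by simp⟩
  have hz0 : z ≠ 0 := by rintro rfl; simp at hz
  -- Division by z turns the factor into a sum of a term with positive and one with nonnegative real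
  -- part.
  have h1 : z⁻¹ + c * s v = 0 := by
    simp at h
    field_simp
    linear_combination h
  have h2 := congrArg Complex.re h1
  simp at h2
  have := mul_nonneg hc (hs v).le
  have : 0 < z.re / Complex.normSq z := div_pos hz (Complex.normSq_pos.2 hz0)
  linarith

theorem TrigStable.one_add_mul_inv_exp {c : ℝ} (hc : 0 ≤ c) (v : V) :
    TrigStable (fun z (θ : V → ℝ) => 1 + (c : ℂ) * z * (Complex.exp (θ v * Complex.I))⁻¹) := by
  classical
  refine ⟨X v + C (Polynomial.C (c : ℂ) * Polynomial.X), Finsupp.single v 1,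
    fun z hz s hs h => ?_, fun z θ => ?_⟩
  · have h := congrArg Complex.re h
    simp at h
    have := mul_nonneg hc hz.le
    have := hs v
    linarith
  · rw [prod_pow_single (fun v => (Complex.exp (θ v * Complex.I))⁻¹)]
    have := Complex.exp_ne_zero (θ v * Complex.I)
    simp
    field_simp

/-- One polynomial serves all shifts α. The second clause is conditional because the extracted
coefficient may vanish identically. -/
theorem TrigStable.exists_polynomial {g : ℂ → (V → ℝ) → ℂ} (hg : TrigStable g) :
    ∃ p : Polynomial ℂ,
      (∀ z (α : ℝ), ∫ θ, g z (fun v => θ v + α) ∂(torusMeasure V) = p.eval z) ∧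
      ((∃ z : ℂ, 0 < z.re ∧ p.eval z ≠ 0) → ∀ z : ℂ, 0 < z.re → p.eval z ≠ 0) := by
  obtain ⟨P, m, hP, hg⟩ := hg
  have hpi : ((2 * Real.pi) ^ Fintype.card V : ℂ) ≠ 0 :=
    pow_ne_zero _ (by exact_mod_cast Real.two_pi_pos.ne')
  refine ⟨Polynomial.C ((2 * Real.pi : ℂ) ^ Fintype.card V) * coeff m P, fun z α => ?_, ?_⟩
  · simp_rw [hg]
    rw [integral_eval_exp_mul, coeff_map]
    simp
  · simp only [Polynomial.eval_mul, Polynomial.eval_C]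
    rintro ⟨z, hz, h⟩ w hw
    exact mul_ne_zero hpi (eval_coeff_ne_zero_of_stable hP m ⟨z, hz, right_ne_zero_of_mul h⟩ w hw)

end ConstantTerm

/-! ### The exponential limit with moving argument -/

section ExpLimit

theorem tendsto_one_add_div_pow {ι : Type*} {l : Filter ι} {n : ι → ℕ} {w : ι → ℂ} {w₀ : ℂ}
    (hn : Tendsto n l atTop) (hw : Tendsto w l (𝓝 w₀)) :
    Tendsto (fun i => (1 + w i / n i) ^ n i) l (𝓝 (Complex.exp w₀)) := by
  have hninv : Tendsto (fun i => ((n i : ℂ))⁻¹) l (𝓝 0) :=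
    (tendsto_inv_atTop_nhds_zero_nat (𝕜 := ℂ)).comp hn
  have hg : Tendsto (fun i => w i / n i) l (𝓝 0) := by
    simpa [div_eq_mul_inv] using hw.mul hninv
  have hd : HasDerivAt (fun u : ℂ => Complex.log (1 + u)) 1 0 := by
    simpa using ((hasDerivAt_id (0 : ℂ)).const_add 1).clog (by simp [Complex.slitPlane])
  -- With φ(u) = log(1 + u)/u continued by φ(0) = 1, n log(1 + w/n) = w φ(w/n), also when w = 0.
  have hφ : Tendsto (dslope (fun u : ℂ => Complex.log (1 + u)) 0) (𝓝 0) (𝓝 1) := by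
    have := (continuousAt_dslope_same.2 hd.differentiableAt).tendsto
    rwa [dslope_same, hd.deriv] at this
  have hlim := (Complex.continuous_exp.tendsto _).comp (hw.mul (hφ.comp hg))
  rw [mul_one] at hlim
  refine hlim.congr' ?_
  filter_upwards [hg.eventually_ne (show (0 : ℂ) ≠ -1 by simp), hn.eventually_ge_atTop 1]
    with i hi hi1
  have hn0 : (n i : ℂ) ≠ 0 := by exact_mod_cast (Nat.one_le_iff_ne_zero.1 hi1)
  have h1 : 1 + w i / n i ≠ 0 := fun h => hi (eq_neg_of_add_eq_zero_right h)
  have h2 := sub_smul_dslope (fun u : ℂ => Complex.log (1 + u)) 0 (w i / n i)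
  simp only [sub_zero, add_zero, Complex.log_one, smul_eq_mul] at h2
  have h3 : w i * dslope (fun u : ℂ => Complex.log (1 + u)) 0 (w i / n i)
      = n i * Complex.log (1 + w i / n i) := by
    rw [← h2]; field_simp
  simp only [Function.comp]
  rw [h3, Complex.exp_nat_mul, Complex.exp_log h1]

theorem norm_one_add_div_pow_le (w : ℂ) (n : ℕ) : ‖(1 + w / n) ^ n‖ ≤ Real.exp ‖w‖ := by
  rcases Nat.eq_zero_or_pos n with rfl | hn
  · simp
  · have hn' : (0 : ℝ) < n := by exact_mod_cast hn
    rw [norm_pow]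
    calc ‖1 + w / n‖ ^ n ≤ Real.exp (‖w‖ / n) ^ n := by
          refine pow_le_pow_left₀ (norm_nonneg _) ?_ n
          refine (norm_add_le _ _).trans ?_
          rw [norm_one, norm_div, Complex.norm_natCast, add_comm]
          exact Real.add_one_le_exp _
      _ = Real.exp ‖w‖ := by
          rw [← Real.exp_nat_mul, mul_div_cancel₀ _ hn'.ne']

end ExpLimit

/-! ### The Gibbs measure and its moment generating function -/

section Density

variable {V : Type*}

theorem pairWeight_mk (J : ℝ) (θ : V → ℝ) (u v : V) :
    pairWeight J θ s(u, v) = edgeWeight J (θ u - θ v) := rfl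

/-- The weight is, up to the constant L, a pointwise limit of continuous products. -/
theorem measurable_edgeWeight {J : ℝ} (hJ : 0 ≤ J) : Measurable (edgeWeight J) := by
  obtain ⟨q, L, K, -, hL, h⟩ := exists_tendsto_thetaProd hJ
  have hm : Measurable fun θ => ((L * edgeWeight J θ : ℝ) : ℂ) := by
    refine measurable_of_tendsto_metrizable (f := fun n θ => thetaProd q n θ) (fun n => ?_)
      (tendsto_pi_nhds.2 fun θ => (h θ).1)
    unfold thetaProd
    simp_rw [← Complex.exp_neg]
    exact Continuous.measurable (by fun_prop)
  convert! (Complex.measurable_re.comp hm).const_mul L⁻¹ using 2 with θ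
  simp [inv_mul_cancel_left₀ hL.ne']

theorem exists_edgeWeight_le {J : ℝ} (hJ : 0 ≤ J) : ∃ K, ∀ θ, edgeWeight J θ ≤ K := by
  obtain ⟨q, L, K, -, hL, h⟩ := exists_tendsto_thetaProd hJ
  refine ⟨K / L, fun θ => ?_⟩
  have := le_of_tendsto (h θ).1.norm (Eventually.of_forall (h θ).2)
  rw [Complex.norm_real] at this
  rw [le_div_iff₀' hL]
  exact (le_abs_self _).trans this

variable (G : SimpleGraph V) [Fintype G.edgeSet] {J : G.edgeSet → ℝ}

theorem density_pos (hJ : ∀ e, 0 ≤ J e) (θ : V → ℝ) : 0 < density G J θ := by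
  refine Finset.prod_pos fun e _ => ?_
  obtain ⟨⟨u, v⟩, h⟩ := Quot.exists_rep e.1
  rw [← h]
  exact edgeWeight_pos (hJ e) _

theorem measurable_density (hJ : ∀ e, 0 ≤ J e) : Measurable (density G J) := by
  refine Finset.measurable_fun_prod _ fun e _ => ?_
  obtain ⟨⟨u, v⟩, h⟩ := Quot.exists_rep e.1
  rw [← h]
  exact (measurable_edgeWeight (hJ e)).comp (by fun_prop)

theorem exists_density_le (hJ : ∀ e, 0 ≤ J e) : ∃ K, ∀ θ, density G J θ ≤ K := by
  choose K hK using fun e => exists_edgeWeight_le (hJ e)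
  refine ⟨∏ e, K e, fun θ => Finset.prod_le_prod (fun e _ => ?_) fun e _ => ?_⟩
  all_goals
    obtain ⟨⟨u, v⟩, h⟩ := Quot.exists_rep e.1
    rw [← h]
  · exact (edgeWeight_pos (hJ e) _).le
  · exact hK e _

variable [Fintype V]

theorem unnormalizedMeasure_univ_ne_zero (hJ : ∀ e, 0 ≤ J e) :
    unnormalizedMeasure G J Set.univ ≠ 0 := by
  rw [unnormalizedMeasure, withDensity_apply _ MeasurableSet.univ, Measure.restrict_univ]
  have hm : Measurable fun θ => ENNReal.ofReal (density G J θ) :=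
    (measurable_density G hJ).ennreal_ofReal
  rw [Ne, lintegral_eq_zero_iff hm]
  intro h
  have h0 : torusMeasure V Set.univ = 0 := by
    rw [← Measure.measure_univ_eq_zero.2 (ae_eq_bot.1 ?_)]
    rw [← Filter.eventually_false_iff_eq_bot]
    filter_upwards [h] with θ hθ
    exact (ENNReal.ofReal_pos.2 (density_pos G hJ θ)).ne' hθ
  rw [Measure.pi_univ, Finset.prod_eq_zero_iff] at h0
  obtain ⟨v, -, hv⟩ := h0
  rw [Measure.restrict_apply_univ, Real.volume_Ioc, ENNReal.ofReal_eq_zero] at hv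
  linarith [Real.pi_pos]

theorem unnormalizedMeasure_univ_ne_top (hJ : ∀ e, 0 ≤ J e) :
    unnormalizedMeasure G J Set.univ ≠ ⊤ := by
  obtain ⟨K, hK⟩ := exists_density_le G hJ
  rw [unnormalizedMeasure, withDensity_apply _ MeasurableSet.univ, Measure.restrict_univ]
  refine ((lintegral_mono fun θ => ENNReal.ofReal_le_ofReal (hK θ)).trans_lt ?_).ne
  rw [lintegral_const]
  exact ENNReal.mul_lt_top ENNReal.ofReal_lt_top (measure_lt_top (torusMeasure V) _)

theorem isProbabilityMeasure_gibbsMeasure (hJ : ∀ e, 0 ≤ J e) :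
    IsProbabilityMeasure (gibbsMeasure G J) :=
  ⟨by
    rw [gibbsMeasure, Measure.smul_apply, smul_eq_mul]
    exact ENNReal.inv_mul_cancel (unnormalizedMeasure_univ_ne_zero G hJ)
      (unnormalizedMeasure_univ_ne_top G hJ)⟩

theorem integral_density_mul (hJ : ∀ e, 0 ≤ J e) (g : (V → ℝ) → ℂ) :
    ∫ θ, (density G J θ : ℂ) * g θ ∂(torusMeasure V)
      = ((unnormalizedMeasure G J Set.univ).toReal : ℂ) * ∫ θ, g θ ∂(gibbsMeasure G J) := by
  have hZ : (unnormalizedMeasure G J Set.univ).toReal ≠ 0 :=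
    (ENNReal.toReal_pos (unnormalizedMeasure_univ_ne_zero G hJ)
      (unnormalizedMeasure_univ_ne_top G hJ)).ne'
  rw [gibbsMeasure, integral_smul_measure, ENNReal.toReal_inv, Complex.real_smul, ← mul_assoc,
    ← Complex.ofReal_mul, mul_inv_cancel₀ hZ, Complex.ofReal_one, one_mul, unnormalizedMeasure,
    integral_withDensity_eq_integral_toReal_smul (measurable_density G hJ).ennreal_ofReal
      (Eventually.of_forall fun _ => ENNReal.ofReal_lt_top)]
  refine integral_congr_ae (Eventually.of_forall fun θ => ?_)
  simp only [ENNReal.toReal_ofReal (density_pos G hJ θ).le, Complex.real_smul]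

theorem continuous_magnetization (lam : V → ℝ) : Continuous (magnetization lam) := by
  unfold magnetization
  fun_prop

theorem abs_magnetization_le (lam : V → ℝ) (θ : V → ℝ) :
    |magnetization lam θ| ≤ ∑ v, |lam v| := by
  refine (Finset.abs_sum_le_sum_abs _ _).trans (Finset.sum_le_sum fun v _ => ?_)
  rw [abs_mul]
  exact mul_le_of_le_one_right (abs_nonneg _) (Real.abs_cos_le_one _)

theorem integrable_exp_magnetization (hJ : ∀ e, 0 ≤ J e) (lam : V → ℝ) (z : ℂ) :
    Integrable (fun θ : V → ℝ => Complex.exp (z * (magnetization lam θ : ℂ)))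
      (gibbsMeasure G J) := by
  have := isProbabilityMeasure_gibbsMeasure G hJ
  have hc := continuous_magnetization lam
  refine Integrable.of_bound (Continuous.aestronglyMeasurable (by fun_prop))
    (Real.exp (‖z‖ * ∑ v, |lam v|)) (Eventually.of_forall fun θ => ?_)
  refine (Complex.norm_exp_le_exp_norm _).trans (Real.exp_le_exp.2 ?_)
  rw [norm_mul, Complex.norm_real]
  exact mul_le_mul_of_nonneg_left (abs_magnetization_le lam θ) (norm_nonneg _)

theorem integral_exp_magnetizationLaw (lam : V → ℝ) (z : ℂ) :
    ∫ θ, Complex.exp (z * (magnetization lam θ : ℂ)) ∂(gibbsMeasure G J)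
      = ∫ x : ℝ, Complex.exp (z * (x : ℂ)) ∂(magnetizationLaw G J lam) := by
  rw [magnetizationLaw, integral_map (continuous_magnetization lam).aemeasurable
    (Continuous.aestronglyMeasurable (by fun_prop))]

theorem differentiable_integral_exp_magnetization (hJ : ∀ e, 0 ≤ J e) (lam : V → ℝ) :
    Differentiable ℂ fun z : ℂ =>
      ∫ θ, Complex.exp (z * (magnetization lam θ : ℂ)) ∂(gibbsMeasure G J) := by
  -- The complex moment generating function is holomorphic over the interior of this set, here all
  -- of ℝ since the magnetization is bounded.
  have hu : ProbabilityTheory.integrableExpSet (magnetization lam) (gibbsMeasure G J)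
      = Set.univ := by
    refine Set.eq_univ_of_forall fun t => ?_
    have := (integrable_exp_magnetization G hJ lam t).re
    refine this.congr (Eventually.of_forall fun θ => ?_)
    simp only [← Complex.ofReal_mul, ← Complex.ofReal_exp]
    rfl
  have h := ProbabilityTheory.differentiableOn_complexMGF (X := magnetization lam)
    (μ := gibbsMeasure G J)
  rw [hu, interior_univ] at h
  intro z
  exact (h z (Set.mem_univ _)).differentiableAt univ_mem

theorem integral_exp_magnetization_one_ne_zero (hJ : ∀ e, 0 ≤ J e) (lam : V → ℝ) :
    ∫ θ, Complex.exp (1 * (magnetization lam θ : ℂ)) ∂(gibbsMeasure G J) ≠ 0 := by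
  have := isProbabilityMeasure_gibbsMeasure G hJ
  have hi := (integrable_exp_magnetization G hJ lam 1).re
  have hrw (θ : V → ℝ) : Complex.exp (1 * (magnetization lam θ : ℂ))
      = ((Real.exp (magnetization lam θ) : ℝ) : ℂ) := by
    rw [one_mul, Complex.ofReal_exp]
  simp_rw [hrw] at hi ⊢
  rw [integral_complex_ofReal]
  exact Complex.ofReal_ne_zero.2 (integral_exp_pos hi).ne'

end Density

/-! ### Approximation and passage to the limit -/

section Approximation

variable {V : Type*} [Fintype V]

/-- The approximation of `exp (z ∑ λ_v cos θ_v)` by a Laurent polynomial in the `exp (i θ_v)`. -/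
noncomputable def fieldApprox (lam : V → ℝ) (n : ℕ) (z : ℂ) (θ : V → ℝ) : ℂ :=
  ∏ v, ((1 + ((lam v / 2 / n : ℝ) : ℂ) * z * Complex.exp (θ v * Complex.I)) ^ n *
    (1 + ((lam v / 2 / n : ℝ) : ℂ) * z * (Complex.exp (θ v * Complex.I))⁻¹) ^ n)

theorem fieldApprox_eq (lam : V → ℝ) (n : ℕ) (z : ℂ) (θ : V → ℝ) :
    fieldApprox lam n z θ =
      ∏ v, ((1 + (lam v / 2) * z * Complex.exp (θ v * Complex.I) / n) ^ n *
        (1 + (lam v / 2) * z * (Complex.exp (θ v * Complex.I))⁻¹ / n) ^ n) := by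
  refine Finset.prod_congr rfl fun v _ => ?_
  push_cast
  congr 3 <;> ring

theorem trigStable_fieldApprox {lam : V → ℝ} (hlam : ∀ v, 0 ≤ lam v) (n : ℕ) :
    TrigStable (fieldApprox lam n) := by
  have hc (v : V) : 0 ≤ lam v / 2 / n := div_nonneg (div_nonneg (hlam v) two_pos.le) n.cast_nonneg
  exact TrigStable.prod _ fun v => ((TrigStable.one_add_mul_exp (hc v) v).pow n).mul
    ((TrigStable.one_add_mul_inv_exp (hc v) v).pow n)

theorem exp_mul_magnetization (lam : V → ℝ) (z : ℂ) (θ : V → ℝ) :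
    Complex.exp (z * (magnetization lam θ : ℂ)) =
      ∏ v, (Complex.exp ((lam v / 2) * z * Complex.exp (θ v * Complex.I)) *
        Complex.exp ((lam v / 2) * z * (Complex.exp (θ v * Complex.I))⁻¹)) := by
  simp_rw [← Complex.exp_add]
  rw [← Complex.exp_sum, magnetization, Complex.ofReal_sum, Finset.mul_sum]
  congr 1
  refine Finset.sum_congr rfl fun v _ => ?_
  rw [Complex.ofReal_mul, Complex.ofReal_cos, Complex.cos, neg_mul, Complex.exp_neg]
  ring

theorem tendsto_fieldApprox (lam : V → ℝ) (z : ℂ) (θ : V → ℝ) :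
    Tendsto (fun p : ℕ × ℂ => fieldApprox lam p.1 p.2 θ) (atTop ×ˢ 𝓝 z)
      (𝓝 (Complex.exp (z * (magnetization lam θ : ℂ)))) := by
  simp_rw [fieldApprox_eq, exp_mul_magnetization]
  refine tendsto_finsetProd _ fun v _ => Tendsto.mul ?_ ?_
  · exact tendsto_one_add_div_pow tendsto_fst ((tendsto_snd.const_mul _).mul_const _)
  · exact tendsto_one_add_div_pow tendsto_fst ((tendsto_snd.const_mul _).mul_const _)

theorem norm_fieldApprox_le (lam : V → ℝ) (n : ℕ) (z : ℂ) (θ : V → ℝ) :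
    ‖fieldApprox lam n z θ‖ ≤ ∏ v, (Real.exp (|lam v| * ‖z‖) * Real.exp (|lam v| * ‖z‖)) := by
  rw [fieldApprox_eq, norm_prod]
  have hb (v : V) (y : ℂ) (hy : ‖y‖ = 1) :
      ‖(1 + (lam v / 2) * z * y / n) ^ n‖ ≤ Real.exp (|lam v| * ‖z‖) := by
    refine (norm_one_add_div_pow_le _ n).trans (Real.exp_le_exp.2 ?_)
    rw [norm_mul, norm_mul, hy, mul_one, norm_div, Complex.norm_real, Complex.norm_ofNat]
    refine mul_le_mul_of_nonneg_right ?_ (norm_nonneg z)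
    rw [Real.norm_eq_abs]
    exact half_le_self (abs_nonneg _)
  refine Finset.prod_le_prod (fun v _ => norm_nonneg _) fun v _ => ?_
  rw [norm_mul]
  have h1 : ‖Complex.exp (θ v * Complex.I)‖ = 1 := Complex.norm_exp_ofReal_mul_I _
  exact mul_le_mul (hb v _ h1) (hb v _ (by rw [norm_inv, h1, inv_one])) (norm_nonneg _)
    (Real.exp_nonneg _)

theorem continuous_fieldApprox (lam : V → ℝ) (n : ℕ) (z : ℂ) :
    Continuous (fieldApprox lam n z) := by
  unfold fieldApprox
  simp_rw [← Complex.exp_neg]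
  fun_prop

/-- Rotation by π changes the sign of every exp(iθ_v), while the differences θ_u - θ_v are
unchanged. -/
theorem fieldApprox_neg (lam : V → ℝ) (n : ℕ) (z : ℂ) (θ : V → ℝ) :
    fieldApprox lam n (-z) θ = fieldApprox lam n z (fun v => θ v + Real.pi) := by
  unfold fieldApprox
  refine Finset.prod_congr rfl fun v _ => ?_
  have : Complex.exp ((θ v + Real.pi : ℝ) * Complex.I) = -Complex.exp (θ v * Complex.I) := by
    rw [Complex.ofReal_add, add_mul, Complex.exp_add, Complex.exp_pi_mul_I, mul_neg_one]
  rw [this, inv_neg]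
  congr 3 <;> ring

theorem continuous_thetaProd (q : ℝ) (n : ℕ) : Continuous (thetaProd q n) := by
  unfold thetaProd
  simp_rw [← Complex.exp_neg]
  fun_prop

theorem trigStable_thetaProd {q : ℝ} (hq : 0 ≤ q) (n : ℕ) (u v : V) :
    TrigStable (fun _ (θ : V → ℝ) => thetaProd q n (θ u - θ v)) := by
  have hexp (θ : V → ℝ) : Complex.exp ((θ u - θ v : ℝ) * Complex.I)
      = Complex.exp (θ u * Complex.I) * (Complex.exp (θ v * Complex.I))⁻¹ := by
    rw [← Complex.exp_neg, ← Complex.exp_add]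
    congr 1
    push_cast
    ring
  have hinv (θ : V → ℝ) : (Complex.exp ((θ u - θ v : ℝ) * Complex.I))⁻¹
      = Complex.exp (θ v * Complex.I) * (Complex.exp (θ u * Complex.I))⁻¹ := by
    rw [hexp, mul_inv, inv_inv, mul_comm]
  unfold thetaProd
  refine TrigStable.prod _ fun j => ?_
  simp_rw [hinv, hexp]
  exact (TrigStable.one_add_exp_sub (pow_nonneg hq _) u v).mul
    (TrigStable.one_add_exp_sub (pow_nonneg hq _) v u)

theorem integral_exp_magnetization_zeros (G : SimpleGraph V) [Fintype G.edgeSet]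
    {J : G.edgeSet → ℝ} (hJ : ∀ e, 0 ≤ J e) {lam : V → ℝ} (hlam : ∀ v, 0 ≤ lam v) {z : ℂ}
    (hz : ∫ θ, Complex.exp (z * (magnetization lam θ : ℂ)) ∂(gibbsMeasure G J) = 0) :
    z.re = 0 := by
  choose q L K hq hL hlim using fun e => exists_tendsto_thetaProd (hJ e)
  have hrep (e : G.edgeSet) : ∃ u v, e.1 = s(u, v) := by
    obtain ⟨⟨u, v⟩, h⟩ := Quot.exists_rep e.1
    exact ⟨u, v, h.symm⟩
  choose a b hab using hrep
  set g : ℕ → ℂ → (V → ℝ) → ℂ := fun n z θ =>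
    (∏ e, thetaProd (q e) n (θ (a e) - θ (b e))) * fieldApprox lam n z θ with hg
  have hgs (n : ℕ) : TrigStable (g n) :=
    (TrigStable.prod _ fun e => trigStable_thetaProd (hq e) n (a e) (b e)).mul
      (trigStable_fieldApprox hlam n)
  choose p hp hp0 using fun n => (hgs n).exists_polynomial
  have hpg (n : ℕ) (z : ℂ) : (p n).eval z = ∫ θ, g n z θ ∂(torusMeasure V) := by
    simpa using (hp n z 0).symm
  -- The product constants L e and the partition function are the only discrepancy between the limit
  -- and f.
  set c : ℂ := ((∏ e, L e : ℝ) : ℂ) * ((unnormalizedMeasure G J Set.univ).toReal : ℂ) with hc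
  have hc0 : c ≠ 0 := by
    refine mul_ne_zero (Complex.ofReal_ne_zero.2 (Finset.prod_pos fun e _ => hL e).ne')
      (Complex.ofReal_ne_zero.2 (ENNReal.toReal_pos (unnormalizedMeasure_univ_ne_zero G hJ)
        (unnormalizedMeasure_univ_ne_top G hJ)).ne')
  set f : ℂ → ℂ := fun z =>
    ∫ θ, Complex.exp (z * (magnetization lam θ : ℂ)) ∂(gibbsMeasure G J) with hf
  have hdens (θ : V → ℝ) : Tendsto (fun n => ∏ e, thetaProd (q e) n (θ (a e) - θ (b e))) atTop
      (𝓝 (((∏ e, L e : ℝ) : ℂ) * (density G J θ : ℂ))) := by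
    have : ((∏ e, L e : ℝ) : ℂ) * (density G J θ : ℂ)
        = ∏ e, ((L e * edgeWeight (J e) (θ (a e) - θ (b e)) : ℝ) : ℂ) := by
      rw [← Complex.ofReal_mul, density, ← Finset.prod_mul_distrib, Complex.ofReal_prod]
      refine Finset.prod_congr rfl fun e _ => ?_
      rw [hab e, pairWeight_mk]
    rw [this]
    exact tendsto_finsetProd _ fun e _ => (hlim e _).1
  have hconv (z : ℂ) : Tendsto (fun x : ℕ × ℂ => (p x.1).eval x.2) (atTop ×ˢ 𝓝 z)
      (𝓝 (c * f z)) := by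
    have hcf : c * f z = ∫ θ, ((∏ e, L e : ℝ) : ℂ) * (density G J θ : ℂ) *
        Complex.exp (z * (magnetization lam θ : ℂ)) ∂(torusMeasure V) := by
      simp_rw [mul_assoc]
      rw [integral_const_mul, integral_density_mul G hJ, hc, mul_assoc]
    rw [hcf]
    simp_rw [hpg]
    refine tendsto_integral_filter_of_dominated_convergence
      (fun _ => (∏ e, K e) *
        ∏ v, (Real.exp (|lam v| * (‖z‖ + 1)) * Real.exp (|lam v| * (‖z‖ + 1))))
      (Eventually.of_forall fun x => ?_) ?_ (integrable_const _)
      (Eventually.of_forall fun θ => ?_)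
    · refine Continuous.aestronglyMeasurable (Continuous.mul ?_ (continuous_fieldApprox _ _ _))
      exact continuous_finsetProd _ fun e _ => (continuous_thetaProd _ _).comp (by fun_prop)
    -- The second argument moves too, so the dominating constant uses the radius ‖z‖ + 1.
    · have hev : ∀ᶠ x : ℕ × ℂ in atTop ×ˢ 𝓝 z, ‖x.2‖ < ‖z‖ + 1 :=
        (tendsto_snd.norm).eventually_lt_const (lt_add_one _)
      filter_upwards [hev] with x hx
      refine Eventually.of_forall fun θ => ?_
      rw [hg, norm_mul, norm_prod]
      have h1 : ∏ e, ‖thetaProd (q e) x.1 (θ (a e) - θ (b e))‖ ≤ ∏ e, K e :=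
        Finset.prod_le_prod (fun e _ => norm_nonneg _) fun e _ => (hlim e _).2 _
      refine mul_le_mul h1 ((norm_fieldApprox_le _ _ _ _).trans ?_) (norm_nonneg _)
        (le_trans (Finset.prod_nonneg fun e _ => norm_nonneg _) h1)
      gcongr
    · exact ((hdens θ).comp tendsto_fst).mul (tendsto_fieldApprox lam z θ)
  have hpoint (z : ℂ) : Tendsto (fun n => (p n).eval z) atTop (𝓝 (c * f z)) :=
    (hconv z).comp (tendsto_id.prodMk tendsto_const_pure |>.mono_right
      (prod_mono le_rfl (pure_le_nhds z)))
  have hf1 : c * f 1 ≠ 0 := mul_ne_zero hc0 (integral_exp_magnetization_one_ne_zero G hJ lam)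
  have hpos : ∀ w ∈ {w : ℂ | 0 < w.re}, c * f w ≠ 0 := by
    refine ne_zero_of_tendsto_of_ne_zero (l := atTop) isOpen_re_pos isPreconnected_re_pos
      (F := fun n z => (p n).eval z)
      (Eventually.of_forall fun n => (p n).differentiable.differentiableOn) ?_
      ((differentiable_integral_exp_magnetization G hJ lam).const_mul c).differentiableOn
      (fun z _ => hconv z) ⟨1, by simp, hf1⟩
    -- Since the limit at 1 is nonzero, p n is eventually nonzero at 1, which rules out the
    -- identically zero case.
    filter_upwards [(hpoint 1).eventually_ne hf1] with n hn w hw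
    exact hp0 n ⟨1, by simp, hn⟩ w hw
  have hsymm (w : ℂ) : c * f (-w) = c * f w := by
    refine tendsto_nhds_unique (hpoint (-w)) ((hpoint w).congr fun n => ?_)
    rw [hpg n (-w), ← hp n w Real.pi]
    refine integral_congr_ae (Eventually.of_forall fun θ => ?_)
    simp only [hg, fieldApprox_neg, add_sub_add_right_eq_sub]
  have hfz : c * f z = 0 := by rw [show f z = 0 from hz, mul_zero]
  by_contra hre
  rcases lt_or_gt_of_ne hre with h | h
  · exact hpos (-z) (by simpa using h) ((hsymm z).trans hfz)
  · exact hpos z h hfz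

end Approximation

end Villain

theorem mainTheorem3 {V : Type*} [Fintype V] (G : SimpleGraph V) [Fintype G.edgeSet]
    (J : G.edgeSet → ℝ) (hJ : ∀ e, 0 ≤ J e) (lam : V → ℝ) (hlam : ∀ v, 0 ≤ lam v) :
    MeasureTheory.IsProbabilityMeasure (Villain.gibbsMeasure G J) ∧
    (∀ z : ℂ, MeasureTheory.Integrable
      (fun θ : V → ℝ => Complex.exp (z * (Villain.magnetization lam θ : ℂ)))
      (Villain.gibbsMeasure G J)) ∧
    (∀ z : ℂ, ∫ θ, Complex.exp (z * (Villain.magnetization lam θ : ℂ)) ∂(Villain.gibbsMeasure G J)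
      = ∫ x : ℝ, Complex.exp (z * (x : ℂ)) ∂(Villain.magnetizationLaw G J lam)) ∧
    ∀ z : ℂ,
      ∫ θ, Complex.exp (z * (Villain.magnetization lam θ : ℂ)) ∂(Villain.gibbsMeasure G J) = 0 →
        z.re = 0 :=
  ⟨Villain.isProbabilityMeasure_gibbsMeasure G hJ,
    Villain.integrable_exp_magnetization G hJ lam,
    Villain.integral_exp_magnetizationLaw G lam,
    fun _ hz => Villain.integral_exp_magnetization_zeros G hJ hlam hz⟩
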